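/- Let $n\ge 1$ and $G=\mathbb{R}^n\setminus\{0\}$. For $x,y\in G$ let $$s_G(x,y)=\sup_{z\in\partial G}\frac{|x-y|}{|z-x|+|z-y|}$$ be the triangular ratio metric and let $$k_G(x,y)=\inf_\gamma\int_\gamma\frac{|dz|}{d(z,\partial G)}$$ be the quasihyperbolic metric, where the infimum is taken over all rectifiable curves $\gamma\subset G$ joining $x$ and $y$ (with $k_G(x,y)=\infty$ if there is no such curve, which can happen only for $n=1$). For $m\in\{s,k\}$, $x\in G$ and $r>0$ write $B_m(x,r)=\{y\in G: m_G(x,y)<r\}$. Then: (1) for every $x\in G$ and $r\in(0,1)$, $\;B_k\bigl(x,\log(1+2r)\bigr)\subset B_s(x,r)$; (2) for every $x\in G$ and $r\in(0,\tfrac12)$, $\;B_s(x,r)\subset B_k\Bigl(x,\,2\arcsin\dfrac{r}{1-r}\Bigr)$. -/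

import Mathlib

open Set MeasureTheory
open scoped ENNReal

noncomputable section

/-- The triangular ratio metric
`s_G(x, y) = sup_{z ∈ ∂G} |x - y| / (|z - x| + |z - y|)` of a proper subdomain `G`.
The quotients always lie in `[0, 1]`, so the real supremum is a genuine one whenever
`∂G` is nonempty. -/
def triangularRatio {E : Type*} [PseudoMetricSpace E] (G : Set E) (x y : E) : ℝ :=
  ⨆ z : frontier G, dist x y / (dist (z : E) x + dist (z : E) y)

/-- The curve integral `∫_γ ρ |dz|` with respect to arc length of a nonnegative function `ρ` over
a rectifiable curve `γ : [a, b] → E`: the integral over `[0, ℓ(γ)]` of `ρ` composed with the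
arc-length parametrization of `γ`, where the length `ℓ(γ)` is the total variation of `γ`. -/
def arcLengthIntegral {E : Type*} [PseudoEMetricSpace E] (ρ : E → ℝ≥0∞) (γ : ℝ → E) (a b : ℝ) :
    ℝ≥0∞ :=
  ∫⁻ t in Icc 0 (eVariationOn γ (Icc a b)).toReal, ρ (naturalParameterization γ (Icc a b) a t)

/-- The restriction of `γ` to `[a, b]` is a rectifiable curve (a continuous curve of finite
length) which lies in `G` and joins `x` to `y`. -/
structure IsRectifiableCurveIn {E : Type*} [PseudoEMetricSpace E] (G : Set E) (x y : E)
    (γ : ℝ → E) (a b : ℝ) : Prop where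
  le : a ≤ b
  continuousOn : ContinuousOn γ (Icc a b)
  rectifiable : eVariationOn γ (Icc a b) ≠ ∞
  mapsTo : MapsTo γ (Icc a b) G
  source : γ a = x
  target : γ b = y

/-- The quasihyperbolic metric `k_G(x, y) = inf_γ ∫_γ |dz| / d(z, ∂G)`, the infimum being taken
over all rectifiable curves in `G` joining `x` and `y`. It takes values in `[0, ∞]`, with the
value `∞` if there is no such curve. -/
def quasihyperbolic {E : Type*} [PseudoEMetricSpace E] (G : Set E) (x y : E) : ℝ≥0∞ :=
  ⨅ (γ : ℝ → E) (a : ℝ) (b : ℝ) (_ : IsRectifiableCurveIn G x y γ a b),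
    arcLengthIntegral (fun z => (Metric.infEDist z (frontier G))⁻¹) γ a b

/-- The ball `B_s(x, r) = {y ∈ G : s_G(x, y) < r}` of the triangular ratio metric. -/
def triangularRatioBall {E : Type*} [PseudoMetricSpace E] (G : Set E) (x : E) (r : ℝ) : Set E :=
  {y ∈ G | triangularRatio G x y < r}

/-- The ball `B_k(x, r) = {y ∈ G : k_G(x, y) < r}` of the quasihyperbolic metric. -/
def quasihyperbolicBall {E : Type*} [PseudoEMetricSpace E] (G : Set E) (x : E) (r : ℝ) : Set E :=
  {y ∈ G | quasihyperbolic G x y < ENNReal.ofReal r}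

end

/-! The boundary of `G` is the origin alone, so `s(x, y) = |x - y| / (|x| + |y|)`, and two
elementary bounds on `k` suffice. Lower bound: after arc length `t` from `x`, a curve is at distance
at most `|x| + t` from the origin; integrating the reciprocal gives `k ≥ log (1 + |x - y| / |x|)`,
and likewise with `y`. Hence `k < log (1 + 2r)` forces `|x - y| < 2r min(|x|, |y|) ≤ r (|x| + |y|)`.
Upper bound: the segment from `x` to `y` stays at distance at least `(|x| + |y| - |x - y|) / 2` from
the origin, so `k ≤ 2s / (1 - s)` when `s < 1`. For `s < r < 1/2` this is less than `2r / (1 - r)`,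
and `u ≤ arcsin u` on `[0, 1]` finishes. -/

section Curves

variable {E : Type*} [PseudoMetricSpace E] {G : Set E} {x y : E} {γ : ℝ → E} {a b t : ℝ}

/-- The variation function of a continuous function of locally bounded variation is continuous. -/
theorem continuousOn_variationOnFromTo {s : Set ℝ} (hc : ContinuousOn γ s)
    (hf : LocallyBoundedVariationOn γ s) (ha : a ∈ s) :
    ContinuousOn (variationOnFromTo γ s a) s := by
  intro c hcs
  -- A one-sided limit of the variation at `c` differs from its value there by the distance between
  -- `γ c` and the one-sided limit of `γ`, here zero.
  have hl : ContinuousWithinAt (variationOnFromTo γ s a) (s ∩ Iio c) c := by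
    simpa [ContinuousWithinAt] using variationOnFromTo.tendsto_left ha hcs hf ((hc c hcs).mono inter_subset_left)
  have hr : ContinuousWithinAt (variationOnFromTo γ s a) (s ∩ Ioi c) c := by
    simpa [ContinuousWithinAt] using variationOnFromTo.tendsto_right ha hcs hf ((hc c hcs).mono inter_subset_left)
  refine ((hl.union hr).union (continuousWithinAt_singleton (x := c))).mono fun z hz => ?_
  rcases lt_trichotomy z c with h | h | h
  · exact Or.inl (Or.inl ⟨hz, h⟩)
  · exact Or.inr h
  · exact Or.inl (Or.inr ⟨hz, h⟩)

/-- The point with arc-length parameter `t` lies on the curve, at distance at most `t` from the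
initial point and at most `ℓ - t` from the end point. -/
theorem IsRectifiableCurveIn.exists_naturalParameterization_eq
    (h : IsRectifiableCurveIn G x y γ a b)
    (ht : t ∈ Icc 0 (eVariationOn γ (Icc a b)).toReal) :
    ∃ c ∈ Icc a b, naturalParameterization γ (Icc a b) a t = γ c ∧ dist x (γ c) ≤ t ∧
      dist (γ c) y ≤ (eVariationOn γ (Icc a b)).toReal - t := by
  have ha : a ∈ Icc a b := left_mem_Icc.2 h.le
  have hb : b ∈ Icc a b := right_mem_Icc.2 h.le
  have hf : LocallyBoundedVariationOn γ (Icc a b) :=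
    BoundedVariationOn.locallyBoundedVariationOn h.rectifiable
  have hL : variationOnFromTo γ (Icc a b) a b = (eVariationOn γ (Icc a b)).toReal := by
    rw [variationOnFromTo.eq_of_le _ _ h.le, inter_self]
  have hdist : ∀ {c d : ℝ}, c ∈ Icc a b → d ∈ Icc a b → c ≤ d →
      dist (γ c) (γ d) ≤ variationOnFromTo γ (Icc a b) c d := fun {c d} hc hd hcd => by
    rw [variationOnFromTo.eq_of_le _ _ hcd]
    exact BoundedVariationOn.dist_le (hf c d hc hd) ⟨hc, le_rfl, hcd⟩ ⟨hd, hcd, le_rfl⟩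
  have hex : ∃ c ∈ Icc a b, variationOnFromTo γ (Icc a b) a c = t := by
    have := intermediate_value_Icc h.le (continuousOn_variationOnFromTo h.continuousOn hf ha)
    rw [variationOnFromTo.self, hL] at this
    exact this ht
  -- `naturalParameterization` evaluates `γ` at this `Function.invFunOn` preimage, hence the `rfl`
  -- below.
  obtain ⟨hc, hct⟩ :=
    @Function.invFunOn_pos _ _ (Icc a b) (variationOnFromTo γ (Icc a b) a) t ⟨a⟩ hex
  refine ⟨_, hc, rfl, ?_, ?_⟩
  · have := hdist ha hc hc.1
    rwa [h.source, hct] at this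
  · have := hdist hc hb hc.2
    have hadd := variationOnFromTo.add hf ha hc hb
    rw [h.target] at this
    rw [hct, hL] at hadd
    linarith

theorem IsRectifiableCurveIn.dist_le (h : IsRectifiableCurveIn G x y γ a b) :
    dist x y ≤ (eVariationOn γ (Icc a b)).toReal := by
  rw [← h.source, ← h.target]
  exact BoundedVariationOn.dist_le h.rectifiable (left_mem_Icc.2 h.le) (right_mem_Icc.2 h.le)

/-- An upper bound of `ρ` along the curve bounds the curve integral by its product with the
length. -/
theorem IsRectifiableCurveIn.arcLengthIntegral_le (h : IsRectifiableCurveIn G x y γ a b)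
    {ρ : E → ℝ≥0∞} {C : ℝ≥0∞} (hC : ∀ c ∈ Icc a b, ρ (γ c) ≤ C) :
    arcLengthIntegral ρ γ a b ≤ C * eVariationOn γ (Icc a b) := by
  refine (setLIntegral_mono' measurableSet_Icc (g := fun _ => C) fun t ht => ?_).trans ?_
  · obtain ⟨c, hc, hce, -⟩ := h.exists_naturalParameterization_eq ht
    rw [hce]
    exact hC c hc
  · rw [setLIntegral_const, Real.volume_Icc, sub_zero, ENNReal.ofReal_toReal h.rectifiable]

end Curves

theorem integral_inv_add {d L : ℝ} (hd : 0 < d) (hL : 0 ≤ L) :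
    ∫ t in (0 : ℝ)..L, (d + t)⁻¹ = Real.log (1 + L / d) := by
  rw [intervalIntegral.integral_comp_add_left (fun u : ℝ => u⁻¹),
    integral_inv_of_pos (by linarith) (by linarith)]
  congr 1
  field_simp
  ring

theorem lintegral_ofReal_eq_of_continuousOn {f : ℝ → ℝ} {L : ℝ} (hL : 0 ≤ L)
    (hf : ContinuousOn f (Icc 0 L)) (h0 : ∀ t ∈ Icc 0 L, 0 ≤ f t) :
    ∫⁻ t in Icc 0 L, ENNReal.ofReal (f t) = ENNReal.ofReal (∫ t in (0 : ℝ)..L, f t) := by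
  rw [intervalIntegral.integral_of_le hL, ← integral_Icc_eq_integral_Ioc,
    ofReal_integral_eq_lintegral_ofReal hf.integrableOn_Icc]
  exact (ae_restrict_iff' measurableSet_Icc).2 (Filter.Eventually.of_forall h0)

section Punctured

variable {E : Type*} [NormedAddCommGroup E] {G : Set E} {x y : E} {γ : ℝ → E} {a b : ℝ}

theorem ofReal_log_le_arcLengthIntegral_left (hx : x ≠ 0)
    (h : IsRectifiableCurveIn G x y γ a b) :
    ENNReal.ofReal (Real.log (1 + dist x y / ‖x‖)) ≤
      arcLengthIntegral (fun z => (Metric.infEDist z {0})⁻¹) γ a b := by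
  have hx' : 0 < ‖x‖ := norm_pos_iff.2 hx
  set L := (eVariationOn γ (Icc a b)).toReal
  have hL : 0 ≤ L := ENNReal.toReal_nonneg
  have hpos : ∀ t ∈ Icc 0 L, 0 < ‖x‖ + t := fun t ht => by linarith [ht.1]
  calc ENNReal.ofReal (Real.log (1 + dist x y / ‖x‖))
      ≤ ENNReal.ofReal (Real.log (1 + L / ‖x‖)) := by
        have := h.dist_le
        gcongr
    _ = ∫⁻ t in Icc 0 L, ENNReal.ofReal (‖x‖ + t)⁻¹ := by
        rw [lintegral_ofReal_eq_of_continuousOn hL, integral_inv_add hx' hL]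
        · exact ContinuousOn.inv₀ (by fun_prop) fun t ht => (hpos t ht).ne'
        · exact fun t ht => (inv_pos.2 (hpos t ht)).le
    _ ≤ _ := by
        refine setLIntegral_mono' measurableSet_Icc fun t ht => ?_
        obtain ⟨c, -, hce, hcx, -⟩ := h.exists_naturalParameterization_eq ht
        simp only [hce]
        rw [Metric.infEDist_singleton, ENNReal.ofReal_inv_of_pos (hpos t ht), edist_dist,
          dist_zero_right]
        gcongr
        rw [dist_comm, dist_eq_norm] at hcx
        linarith [norm_le_norm_add_norm_sub' (γ c) x]

/-- Arc length is measured back from the end point: at parameter `t` the norm is at most `‖y‖ + (L -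
t)`, and the substitution `t ↦ L - t` gives the logarithm. -/
theorem ofReal_log_le_arcLengthIntegral_right (hy : y ≠ 0)
    (h : IsRectifiableCurveIn G x y γ a b) :
    ENNReal.ofReal (Real.log (1 + dist x y / ‖y‖)) ≤
      arcLengthIntegral (fun z => (Metric.infEDist z {0})⁻¹) γ a b := by
  have hy' : 0 < ‖y‖ := norm_pos_iff.2 hy
  set L := (eVariationOn γ (Icc a b)).toReal
  have hL : 0 ≤ L := ENNReal.toReal_nonneg
  have hpos : ∀ t ∈ Icc 0 L, 0 < ‖y‖ + (L - t) := fun t ht => by linarith [ht.2]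
  calc ENNReal.ofReal (Real.log (1 + dist x y / ‖y‖))
      ≤ ENNReal.ofReal (Real.log (1 + L / ‖y‖)) := by
        have := h.dist_le
        gcongr
    _ = ∫⁻ t in Icc 0 L, ENNReal.ofReal (‖y‖ + (L - t))⁻¹ := by
        rw [lintegral_ofReal_eq_of_continuousOn hL,
          intervalIntegral.integral_comp_sub_left (fun u : ℝ => (‖y‖ + u)⁻¹), sub_self, sub_zero,
          integral_inv_add hy' hL]
        · exact ContinuousOn.inv₀ (by fun_prop) fun t ht => (hpos t ht).ne'
        · exact fun t ht => (inv_pos.2 (hpos t ht)).le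
    _ ≤ _ := by
        refine setLIntegral_mono' measurableSet_Icc fun t ht => ?_
        obtain ⟨c, -, hce, -, hcy⟩ := h.exists_naturalParameterization_eq ht
        simp only [hce]
        rw [Metric.infEDist_singleton, ENNReal.ofReal_inv_of_pos (hpos t ht), edist_dist,
          dist_zero_right]
        gcongr
        rw [dist_eq_norm] at hcy
        linarith [norm_le_norm_add_norm_sub' (γ c) y]

variable [NormedSpace ℝ E] [Nontrivial E]

theorem frontier_compl_zero : frontier ({0}ᶜ : Set E) = {0} := by
  -- In a nontrivial real space `0` is not isolated, so `{0}` has empty interior.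
  have : (nhdsWithin (0 : E) {0}ᶜ).NeBot := Module.punctured_nhds_neBot ℝ E 0
  rw [frontier_compl, isClosed_singleton.frontier_eq, interior_singleton, sdiff_empty]

theorem triangularRatio_compl_zero (x y : E) :
    triangularRatio {0}ᶜ x y = dist x y / (‖x‖ + ‖y‖) := by
  rw [triangularRatio, frontier_compl_zero]
  simp [ciSup_unique]

/-- The distance-ratio metric is a lower bound of the quasihyperbolic metric. -/
theorem ofReal_log_le_quasihyperbolic (hx : x ≠ 0) (hy : y ≠ 0) :
    ENNReal.ofReal (Real.log (1 + dist x y / min ‖x‖ ‖y‖)) ≤ quasihyperbolic {0}ᶜ x y := by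
  rw [quasihyperbolic, frontier_compl_zero]
  refine le_iInf fun γ => le_iInf fun a => le_iInf fun b => le_iInf fun h => ?_
  rcases min_choice ‖x‖ ‖y‖ with hm | hm <;> rw [hm]
  · exact ofReal_log_le_arcLengthIntegral_left hx h
  · exact ofReal_log_le_arcLengthIntegral_right hy h

/-- The segment from `x` to `y` stays at distance at least `(‖x‖ + ‖y‖ - dist x y) / 2` from the
origin, which bounds the quasihyperbolic metric from above. -/
theorem quasihyperbolic_le_of_dist_lt (h : dist x y < ‖x‖ + ‖y‖) :
    quasihyperbolic {0}ᶜ x y ≤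
      ENNReal.ofReal (2 * dist x y / (‖x‖ + ‖y‖ - dist x y)) := by
  have hm : 0 < (‖x‖ + ‖y‖ - dist x y) / 2 := by linarith
  set γ : ℝ → E := fun t => AffineMap.lineMap x y t with hγ
  have hnorm : ∀ t ∈ Icc (0 : ℝ) 1, (‖x‖ + ‖y‖ - dist x y) / 2 ≤ ‖γ t‖ := fun t ht => by
    have h1 : ‖x - γ t‖ = t * dist x y := by
      rw [← dist_eq_norm, hγ, dist_left_lineMap, Real.norm_of_nonneg ht.1]
    have h2 : ‖y - γ t‖ = (1 - t) * dist x y := by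
      rw [← dist_eq_norm, hγ, dist_right_lineMap, Real.norm_of_nonneg (by linarith [ht.2])]
    -- Adding the two triangle inequalities gives `‖x‖ + ‖y‖ ≤ 2 ‖γ t‖ + dist x y`.
    linarith [norm_le_norm_add_norm_sub' x (γ t), norm_le_norm_add_norm_sub' y (γ t)]
  have hlip : LipschitzWith (nndist x y) γ := lipschitzWith_lineMap x y
  have hvar : eVariationOn γ (Icc 0 1) ≤ ENNReal.ofReal (dist x y) := by
    have := hlip.lipschitzOnWith (s := univ) |>.comp_eVariationOn_le
      (g := (id : ℝ → ℝ)) (s := Icc 0 1) (mapsTo_univ _ _)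
    rw [eVariationOn_id_Icc] at this
    simpa [← edist_nndist, edist_dist] using this
  have hcurve : IsRectifiableCurveIn {0}ᶜ x y γ 0 1 :=
    { le := zero_le_one
      continuousOn := hlip.continuous.continuousOn
      rectifiable := ne_top_of_le_ne_top ENNReal.ofReal_ne_top hvar
      mapsTo := fun t ht => norm_pos_iff.1 (hm.trans_le (hnorm t ht))
      source := AffineMap.lineMap_apply_zero x y
      target := AffineMap.lineMap_apply_one x y }
  rw [quasihyperbolic, frontier_compl_zero]
  refine (iInf₂_le_of_le γ 0 (iInf₂_le 1 hcurve)).trans ?_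
  refine (hcurve.arcLengthIntegral_le
    (C := ENNReal.ofReal ((‖x‖ + ‖y‖ - dist x y) / 2)⁻¹) fun t ht => ?_).trans ?_
  · rw [Metric.infEDist_singleton, ENNReal.ofReal_inv_of_pos hm, edist_dist, dist_zero_right]
    have := hnorm t ht
    gcongr
  · refine (mul_le_mul_right hvar _).trans_eq ?_
    rw [← ENNReal.ofReal_mul (inv_pos.2 hm).le, inv_div]
    congr 1
    ring

theorem quasihyperbolicBall_subset_triangularRatioBall (hx : x ≠ 0) {r : ℝ} (hr : 0 < r) :
    quasihyperbolicBall {0}ᶜ x (Real.log (1 + 2 * r)) ⊆ triangularRatioBall {0}ᶜ x r := by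
  rintro y ⟨hy, hk⟩
  have hx' : 0 < ‖x‖ := norm_pos_iff.2 hx
  have hy' : 0 < ‖y‖ := norm_pos_iff.2 hy
  have hm : 0 < min ‖x‖ ‖y‖ := lt_min hx' hy'
  refine ⟨hy, ?_⟩
  have hlt := (ENNReal.ofReal_lt_ofReal_iff (Real.log_pos (by linarith))).1
    ((ofReal_log_le_quasihyperbolic hx hy).trans_lt hk)
  have h1 := (Real.log_lt_log_iff (by positivity) (by positivity)).1 hlt
  have h2 : dist x y < 2 * r * min ‖x‖ ‖y‖ := (div_lt_iff₀ hm).1 (by linarith)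
  rw [triangularRatio_compl_zero, div_lt_iff₀ (by positivity)]
  calc dist x y < r * (2 * min ‖x‖ ‖y‖) := by linarith
    _ ≤ r * (‖x‖ + ‖y‖) := by
      gcongr
      linarith [min_le_left ‖x‖ ‖y‖, min_le_right ‖x‖ ‖y‖]

theorem triangularRatioBall_subset_quasihyperbolicBall (hx : x ≠ 0) {r : ℝ} (hr : 0 < r)
    (hr' : r < 1 / 2) :
    triangularRatioBall {0}ᶜ x r ⊆
      quasihyperbolicBall {0}ᶜ x (2 * Real.arcsin (r / (1 - r))) := by
  rintro y ⟨hy, hs⟩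
  have hS : 0 < ‖x‖ + ‖y‖ := add_pos (norm_pos_iff.2 hx) (norm_pos_iff.2 hy)
  rw [triangularRatio_compl_zero, div_lt_iff₀ hS] at hs
  have hD : dist x y < ‖x‖ + ‖y‖ := by nlinarith
  have hw : 0 < r / (1 - r) := div_pos hr (by linarith)
  -- The condition `r < 1 / 2` keeps the argument where `Real.arcsin` truly inverts the sine.
  have hw1 : r / (1 - r) ≤ 1 := (div_le_one (by linarith)).2 (by linarith)
  have harc : r / (1 - r) ≤ Real.arcsin (r / (1 - r)) := by
    rw [Real.le_arcsin_iff_sin_le ⟨by linarith [Real.pi_gt_three], by linarith [Real.pi_gt_three]⟩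
      ⟨by linarith, hw1⟩]
    exact Real.sin_le hw.le
  refine ⟨hy, (quasihyperbolic_le_of_dist_lt hD).trans_lt ?_⟩
  refine (ENNReal.ofReal_lt_ofReal_iff (by linarith)).2 (lt_of_lt_of_le ?_
    (mul_le_mul_of_nonneg_left harc zero_le_two))
  -- Clearing denominators reduces `s / (1 - s) < r / (1 - r)` to `s < r`, which is `hs`.
  rw [← mul_div_assoc, div_lt_div_iff₀ (by linarith) (by linarith)]
  linarith

end Punctured

theorem mainTheorem9 (n : ℕ) (x : EuclideanSpace ℝ (Fin n))
    (hx : x ∈ ({0}ᶜ : Set (EuclideanSpace ℝ (Fin n)))) :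
    (∀ r : ℝ, 0 < r → r < 1 →
      quasihyperbolicBall {0}ᶜ x (Real.log (1 + 2 * r)) ⊆ triangularRatioBall {0}ᶜ x r) ∧
    (∀ r : ℝ, 0 < r → r < 1 / 2 →
      triangularRatioBall {0}ᶜ x r ⊆
        quasihyperbolicBall {0}ᶜ x (2 * Real.arcsin (r / (1 - r)))) := by
  -- The nonzero point `x` itself excludes `n = 0`.
  have : Nontrivial (EuclideanSpace ℝ (Fin n)) := ⟨x, 0, hx⟩
  exact ⟨fun r hr _ => quasihyperbolicBall_subset_triangularRatioBall hx hr,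
    fun r hr hr' => triangularRatioBall_subset_quasihyperbolicBall hx hr hr'⟩
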